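/- For a positive integer $n$ let $S_n$ be the set of permutations of $\{1,\dots,n\}$ with the infinity metric $d(f,g)=\max_{1\le i\le n}|f(i)-g(i)|$, and let $B_{r,n}(f)=\{g\in S_n : d(f,g)\le r\}$ be the ball of radius $r$ centered at $f\in S_n$; its size does not depend on $f$. Fix a real number $\rho$ with $0<\rho<1$. Then there is a positive function $n\mapsto\varphi_2(\rho,n)$ such that $$|B_{r,n}(f)|\ \ge\ \varphi_2(\rho,n)$$ for every $n\ge 1$ for which $r=\rho\,(n-1)$ is an integer and every $f\in S_n$, and, as $n\to\infty$ with $\rho$ fixed, $$\log_2\varphi_2(\rho,n)=\begin{cases} n\log_2 n-n\left[\log_2 e-1+\rho-\log_2\rho\right]+o(n), & 0<\rho\le\tfrac12,\\[2mm] n\log_2 n-n\left[\log_2 e+2(1-\rho)^2\right]+o(n), & \tfrac12\le\rho<1.\end{cases}$$ -/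

import Mathlib

/-- The infinity metric on the permutations of an `n`-element linearly ordered set,
`d(f, g) = max_i |f i - g i|`. The points are numbered `0, …, n - 1`, which gives the same
differences as the numbering `1, …, n`. -/
def permInfDist {n : ℕ} (f g : Equiv.Perm (Fin n)) : ℕ :=
  Finset.univ.sup fun i : Fin n => (((f i : ℕ) : ℤ) - ((g i : ℕ) : ℤ)).natAbs

/-- The ball of radius `r` centered at `f` in the infinity metric. -/
def permBall {n : ℕ} (r : ℕ) (f : Equiv.Perm (Fin n)) : Finset (Equiv.Perm (Fin n)) :=
  Finset.univ.filter fun g => permInfDist f g ≤ r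

/-!
The ball is bounded below by counting permutations with a prescribed block profile; the van der
Waerden theorem on permanents is not needed.

Cut `{0, …, K * s - 1}` into `K` consecutive blocks of length `s`, and let `N` be a `K × K` matrix
of natural numbers whose rows and columns all sum to `s`. The number of permutations that send
exactly `N a b` points of block `a` into block `b` is `(s!) ^ (2 * K) / ∏ N a b !`: permuting the
points within the blocks, both in the source and in the target, acts transitively on these
permutations, and the stabilizer is the group of permutations that preserve both the block of a
point and the block of its image. Only the lower bound is needed
(`sq_prod_factorial_card_fiber_le`, `exists_perm_card_fiber_eq`). If `N` is supported on
`|a - b| ≤ R` and `(R + 1) * s ≤ r + 1`, all these permutations lie in the ball of radius `r`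
around the identity (`factorial_pow_le_prod_mul_card_permBall`).

The profile used is a multiple of `bandMatrix K R`: the indicator of the band `|a - b| ≤ R`, with
the entries doubled in two triangular corners so that all rows and columns sum to
`D = min (2 * R + 1) K`. By Stirling's formula, for fixed `K` and `R` the logarithm of the count is
`n log n - n (1 + log (K / D) + 2 log 2 * m (m + 1) / (K D)) + O(log n)`, where
`m = min R (K - 1 - R)` is the side length of the corners (`le_log_card_permBall`). Letting
`K → ∞` with `R / K → ρ` turns the coefficient of `-n` into `1 + profileRate ρ`, which is `log 2`
times the bracket of the theorem in either range of `ρ`.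

This gives a lower bound `log₂ |B| ≥ F n - o(n)` with `F` the asymptotic formula. Since `φ₂` must
satisfy the formula in both directions, it is taken to be the minimum of `2 ^ F n` and the size of
the ball of radius `⌊ρ (n - 1)⌋` (`exists_lower_bound_of_isLittleO`).
-/

/-! ### Permutations with a prescribed block profile -/

open Equiv in
/-- Let `f` label the points and let `H` be the group of permutations preserving `f`. The double
coset `H σ₀ H` has at least `|H| ^ 2 / |Stab|` elements, where `Stab` is the group preserving the
pair of labels `(f a, f (σ₀ a))`; both orders are products of factorials of fiber sizes. Every `σ`
in the double coset has only label pairs `(f a, f (σ a))` that already occur for `σ₀`. -/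
theorem sq_prod_factorial_card_fiber_le {α ι : Type*} [Fintype α] [DecidableEq α]
    [Fintype ι] [DecidableEq ι] (f : α → ι) (σ₀ : Perm α) (S : Finset (Perm α))
    (hS : ∀ σ : Perm α, (∀ a, ∃ b, f b = f a ∧ f (σ₀ b) = f (σ a)) → σ ∈ S) :
    (∏ i, (Fintype.card {a // f a = i}).factorial) ^ 2 ≤
      (∏ p : ι × ι, (Fintype.card {a // (f a, f (σ₀ a)) = p}).factorial) *
        S.card := by
  classical
  rw [← DomMulAct.stabilizer_card f, ← DomMulAct.stabilizer_card fun a => (f a, f (σ₀ a)), sq,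
    ← Fintype.card_prod, ← Finset.card_univ]
  let Φ : {g : Perm α // f ∘ g = f} × {g : Perm α // f ∘ g = f} → Perm α :=
    fun x => x.2.1 * σ₀ * x.1.1
  have inv : ∀ g : Perm α, f ∘ g = f → ∀ a, f (g⁻¹ a) = f a := fun g hg a => by
    simpa using (congrFun hg (g⁻¹ a)).symm
  refine (Finset.card_le_mul_card_image (f := Φ) Finset.univ _ ?_).trans
    (Nat.mul_le_mul_left _ (Finset.card_le_card ?_))
  · intro τ hτ
    obtain ⟨⟨⟨g₀, hg₀⟩, ⟨h₀, hh₀⟩⟩, -, rfl⟩ := Finset.mem_image.1 hτ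
    rw [← Fintype.card_subtype]
    -- two representations of the same element of the double coset differ by `k = g * g₀⁻¹`, which
    -- lies in `H` together with `σ₀ * k * σ₀⁻¹ = h⁻¹ * h₀`
    have key : ∀ g h : Perm α, h * σ₀ * g = h₀ * σ₀ * g₀ → σ₀ * (g * g₀⁻¹) = h⁻¹ * h₀ * σ₀ := by
      intro g h e
      rw [mul_assoc, ← mul_assoc] at *
      have : g = (h * σ₀)⁻¹ * (h₀ * σ₀ * g₀) := by rw [← e]; group
      rw [this]; group
    refine Fintype.card_le_of_injective
      (fun x => ⟨x.1.1.1 * g₀⁻¹, ?_⟩) ?_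
    · obtain ⟨⟨⟨g, hg⟩, ⟨h, hh⟩⟩, e⟩ := x
      have k := key g h e
      funext a
      have k' : σ₀ (g (g₀⁻¹ a)) = h⁻¹ (h₀ (σ₀ a)) := by
        simpa using congrArg (fun τ : Perm α => τ a) k
      have e1 : f (g (g₀⁻¹ a)) = f a := (congrFun hg _).trans (inv g₀ hg₀ a)
      have e2 : f (σ₀ (g (g₀⁻¹ a))) = f (σ₀ a) := by
        rw [k', inv h hh]; exact congrFun hh₀ _
      simpa using ⟨e1, e2⟩
    · rintro ⟨⟨⟨g, hg⟩, ⟨h, hh⟩⟩, e⟩ ⟨⟨⟨g', hg'⟩, ⟨h', hh'⟩⟩, e'⟩ hxy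
      have h1 : g = g' := by simpa using hxy
      subst h1
      have h2 : h * σ₀ * g = h' * σ₀ * g := e.trans e'.symm
      have h3 : h = h' := by simpa using h2
      subst h3
      rfl
  · intro τ hτ
    obtain ⟨⟨⟨g, hg⟩, ⟨h, hh⟩⟩, -, rfl⟩ := Finset.mem_image.1 hτ
    refine hS _ fun a => ⟨g a, congrFun hg a, ?_⟩
    exact (congrFun hh (σ₀ (g a))).symm

open Equiv in
/-- Any matrix `N` whose row and column sums agree with the fiber sizes of `f` is the profile of a
permutation. Think of `N i j` as the number of edges from `i` to `j`: the edges can be matched with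
the points of `α` according to their sources, and also according to their targets. -/
theorem exists_perm_card_fiber_eq {α ι : Type*} [Fintype α] [DecidableEq α]
    [Fintype ι] [DecidableEq ι] (f : α → ι) (N : ι → ι → ℕ)
    (hrow : ∀ i, ∑ j, N i j = Fintype.card {a // f a = i})
    (hcol : ∀ j, ∑ i, N i j = Fintype.card {a // f a = j}) :
    ∃ σ₀ : Perm α, ∀ p : ι × ι, Fintype.card {a // (f a, f (σ₀ a)) = p} = N p.1 p.2 := by
  classical
  let E := Σ p : ι × ι, Fin (N p.1 p.2)
  have card : ∀ (P : ι × ι → Prop) [DecidablePred P], Fintype.card {e : E // P e.1} =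
      ∑ i, ∑ j, if P (i, j) then N i j else 0 := by
    intro P _
    rw [Fintype.card_subtype, Finset.card_filter, Fintype.sum_sigma, Fintype.sum_prod_type]
    simp [apply_ite Finset.card]
  have hx : ∀ i, Nonempty ({e : E // e.1.1 = i} ≃ {a // f a = i}) := fun i => by
    rw [← Fintype.card_eq, card fun p => p.1 = i, ← hrow]
    rw [Finset.sum_eq_single i] <;> simp +contextual
  have hy : ∀ j, Nonempty ({e : E // e.1.2 = j} ≃ {a // f a = j}) := fun j => by
    rw [← Fintype.card_eq, card fun p => p.2 = j, ← hcol]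
    simp
  let x : E ≃ α := Equiv.ofFiberEquiv fun i => (hx i).some
  let y : E ≃ α := Equiv.ofFiberEquiv fun j => (hy j).some
  have fx : ∀ e, f (x e) = e.1.1 := fun e => Equiv.ofFiberEquiv_map _ e
  have fy : ∀ e, f (y e) = e.1.2 := fun e => Equiv.ofFiberEquiv_map _ e
  refine ⟨x.symm.trans y, fun p => ?_⟩
  have h : Fintype.card {e : E // e.1 = p} = N p.1 p.2 := by
    obtain ⟨k, l⟩ := p
    rw [card fun q => q = (k, l), Finset.sum_eq_single k, Finset.sum_eq_single l] <;>
      simp +contextual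
  rw [← h]
  refine (Fintype.card_congr (x.subtypeEquiv fun e => ?_)).symm
  rw [fx, Equiv.trans_apply, Equiv.symm_apply_apply, fy]

/-! ### Balls in the infinity metric -/

theorem mem_permBall {n r : ℕ} {f g : Equiv.Perm (Fin n)} :
    g ∈ permBall r f ↔ ∀ i, (((f i : ℕ) : ℤ) - ((g i : ℕ) : ℤ)).natAbs ≤ r := by
  simp [permBall, permInfDist, Finset.sup_le_iff]

theorem card_permBall_eq_one {n : ℕ} (r : ℕ) (f : Equiv.Perm (Fin n)) :
    (permBall r f).card = (permBall r (1 : Equiv.Perm (Fin n))).card := by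
  refine Finset.card_bij' (fun g _ => g * f⁻¹) (fun g _ => g * f) ?_ ?_ ?_ ?_
  · intro g hg
    rw [mem_permBall] at hg ⊢
    intro i
    simpa using hg (f⁻¹ i)
  · intro g hg
    rw [mem_permBall] at hg ⊢
    intro i
    simpa using hg (f i)
  · simp
  · simp

theorem one_mem_permBall {n : ℕ} (r : ℕ) : (1 : Equiv.Perm (Fin n)) ∈ permBall r 1 := by
  simp [mem_permBall]

/-- A permutation of the first `m` points extends to `n ≥ m` points by fixing the others. -/
theorem card_permBall_mono {m n r r' : ℕ} (hmn : m ≤ n) (hr : r ≤ r') :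
    (permBall r (1 : Equiv.Perm (Fin m))).card ≤
      (permBall r' (1 : Equiv.Perm (Fin n))).card := by
  obtain ⟨t, rfl⟩ := Nat.exists_eq_add_of_le hmn
  refine Finset.card_le_card_of_injOn
    (fun σ => finSumFinEquiv.permCongr (Equiv.Perm.sumCongr σ 1)) ?_ ?_
  · intro σ hσ
    have hσ' := mem_permBall.1 hσ
    refine mem_permBall.2 fun i => ?_
    refine Fin.addCases (fun i => ?_) (fun i => ?_) i
    · simpa using (hσ' i).trans hr
    · simp
  · intro σ _ τ _ h
    have h' := finSumFinEquiv.permCongr.injective h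
    ext i
    have := congrArg (fun e : Equiv.Perm (Fin m ⊕ Fin t) => e (Sum.inl i)) h'
    exact congrArg Fin.val (show σ i = τ i by simpa using this)

/-- The ball contains at least `(s!) ^ (2 * K) / ∏ N a b !` permutations whenever `N` is a block
profile supported on the blocks with `|a - b| ≤ R`: points of two such blocks of length `s` are at
distance at most `(R + 1) * s - 1`. -/
theorem factorial_pow_le_prod_mul_card_permBall {K s r R : ℕ} (N : Fin K → Fin K → ℕ)
    (hrow : ∀ a, ∑ b, N a b = s) (hcol : ∀ b, ∑ a, N a b = s)
    (hband : ∀ a b : Fin K, N a b ≠ 0 → (((a : ℕ) : ℤ) - ((b : ℕ) : ℤ)).natAbs ≤ R)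
    (hr : (R + 1) * s ≤ r + 1) :
    s.factorial ^ (2 * K) ≤ (∏ a, ∏ b, (N a b).factorial) *
      (permBall r (1 : Equiv.Perm (Fin (K * s)))).card := by
  classical
  let f : Fin (K * s) → Fin K := Fin.divNat
  have hf : ∀ a, Fintype.card {i // f i = a} = s := by
    intro a
    have e : {i // f i = a} ≃ {p : Fin K × Fin s // p.1 = a} :=
      finProdFinEquiv.symm.subtypeEquiv fun i => Iff.rfl
    rw [Fintype.card_congr e, Fintype.card_subtype, Finset.card_filter, Fintype.sum_prod_type]
    simp [apply_ite Finset.card]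
  obtain ⟨σ₀, hσ₀⟩ := exists_perm_card_fiber_eq f N (fun a => by rw [hrow, hf])
    (fun b => by rw [hcol, hf])
  have h := sq_prod_factorial_card_fiber_le f σ₀ (permBall r 1) fun σ hσ => ?_
  · simp only [hf, hσ₀, Finset.prod_const, Finset.card_univ, Fintype.card_fin,
      Fintype.prod_prod_type] at h
    rwa [← pow_mul, mul_comm K 2] at h
  refine mem_permBall.2 fun i => ?_
  obtain ⟨j, hj, hj'⟩ := hσ i
  have hN : N (f i) (f (σ i)) ≠ 0 := by
    rw [← hj, ← hj', ← hσ₀ (f j, f (σ₀ j))]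
    exact (Fintype.card_pos_iff.2 ⟨⟨j, rfl⟩⟩).ne'
  have hb := hband _ _ hN
  have hs : 0 < s := Nat.pos_of_ne_zero fun h0 => by
    subst h0; exact absurd i.isLt (by simp)
  have d1 : (f i : ℕ) * s ≤ i := Nat.div_mul_le_self _ _
  have d2 : (i : ℕ) < ((f i : ℕ) + 1) * s := Nat.lt_mul_of_div_lt (Nat.lt_succ_self _) hs
  have d3 : (f (σ i) : ℕ) * s ≤ σ i := Nat.div_mul_le_self _ _
  have d4 : (σ i : ℕ) < ((f (σ i) : ℕ) + 1) * s :=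
    Nat.lt_mul_of_div_lt (Nat.lt_succ_self _) hs
  have b1 : (f i : ℕ) * s ≤ ((f (σ i) : ℕ) + R) * s := Nat.mul_le_mul_right _ (by omega)
  have b2 : (f (σ i) : ℕ) * s ≤ ((f i : ℕ) + R) * s := Nat.mul_le_mul_right _ (by omega)
  simp only [Equiv.Perm.coe_one, id_eq]
  simp only [add_mul, one_mul] at *
  omega

/-! ### The block band matrix with doubled corners -/

/-- The `K × K` matrix that is `1` on the band `|a - b| ≤ R`, except that the entries are `2` in
the two corners `a + b < m` and `(K - 1 - a) + (K - 1 - b) < m`, where `m = min R (K - 1 - R)`, and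
is `0` off the band. Indices are natural numbers, meant to be less than `K`. -/
def bandMatrix (K R a b : ℕ) : ℕ :=
  (if a ≤ b + R ∧ b ≤ a + R then 1 else 0) +
    (if a + b < min R (K - 1 - R) then 1 else 0) +
    (if 2 * K - 1 - min R (K - 1 - R) ≤ a + b then 1 else 0)

theorem bandMatrix_comm (K R a b : ℕ) : bandMatrix K R a b = bandMatrix K R b a := by
  simp only [bandMatrix, add_comm b a, and_comm]

/-- The doubled corners make all row sums equal: row `a` of the band is cut off at the left if
`a < R` and at the right if `a + R ≥ K`, and the corners restore what is needed. -/
theorem sum_bandMatrix {K R : ℕ} (hR : R < K) (a : Fin K) :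
    ∑ b : Fin K, bandMatrix K R a b = min (2 * R + 1) K := by
  obtain ⟨a, ha⟩ := a
  rw [Fin.sum_univ_eq_sum_range (bandMatrix K R a) K]
  simp only [bandMatrix, Finset.sum_add_distrib, ← Finset.card_filter]
  have h1 : (Finset.range K).filter (fun b => a ≤ b + R ∧ b ≤ a + R) =
      Finset.Ico (a - R) (min K (a + R + 1)) := by
    ext b; simp only [Finset.mem_filter, Finset.mem_range, Finset.mem_Ico]; omega
  have h2 : (Finset.range K).filter (fun b => a + b < min R (K - 1 - R)) =
      Finset.range (min R (K - 1 - R) - a) := by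
    ext b; simp only [Finset.mem_filter, Finset.mem_range]; omega
  have h3 : (Finset.range K).filter (fun b => 2 * K - 1 - min R (K - 1 - R) ≤ a + b) =
      Finset.Ico (2 * K - 1 - min R (K - 1 - R) - a) K := by
    ext b; simp only [Finset.mem_filter, Finset.mem_range, Finset.mem_Ico]; omega
  rw [h1, h2, h3, Nat.card_Ico, Nat.card_Ico, Finset.card_range]
  omega

theorem le_add_of_bandMatrix_ne_zero {K R a b : ℕ} (ha : a < K) (hb : b < K)
    (h : bandMatrix K R a b ≠ 0) : a ≤ b + R ∧ b ≤ a + R := by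
  simp only [bandMatrix] at h
  split_ifs at h <;> omega

theorem sum_range_sub_le (K m : ℕ) : ∑ a ∈ Finset.range K, (m - a) ≤ m * (m + 1) / 2 := by
  calc ∑ a ∈ Finset.range K, (m - a) ≤ ∑ a ∈ Finset.range (max K (m+1)), (m - a) :=
        Finset.sum_le_sum_of_subset (by simp)
    _ = ∑ a ∈ Finset.range (m + 1), (m - a) := by
        refine (Finset.sum_subset (by simp) fun x _ hx => ?_).symm
        simp at hx; omega
    _ = ∑ a ∈ Finset.range (m + 1), a := Finset.sum_range_reflect (fun a => a) (m + 1)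
    _ = m * (m + 1) / 2 := by rw [Finset.sum_range_id, mul_comm]; rfl

/-- Only the entries equal to `2` contribute, and there are `m * (m + 1)` of them. -/
theorem sum_bandMatrix_mul_log_le {K R : ℕ} (hR : R < K) :
    ∑ a : Fin K, ∑ b : Fin K, (bandMatrix K R a b : ℝ) * Real.log (bandMatrix K R a b) ≤
      2 * Real.log 2 * (min R (K - 1 - R) * (min R (K - 1 - R) + 1) : ℕ) := by
  set m := min R (K - 1 - R) with hm
  have h1 : ∀ a b : Fin K, (bandMatrix K R a b : ℝ) * Real.log (bandMatrix K R a b) =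
      2 * Real.log 2 * ((if (a : ℕ) + b < m then 1 else 0) +
        (if 2 * K - 1 - m ≤ (a : ℕ) + b then 1 else 0) : ℕ) := by
    intro a b
    have := a.2
    have := b.2
    simp only [bandMatrix, ← hm]
    split_ifs <;> first | omega | (norm_num)
  have h2 : ∑ a : Fin K, ∑ b : Fin K, ((if (a : ℕ) + b < m then 1 else 0) +
        (if 2 * K - 1 - m ≤ (a : ℕ) + b then 1 else 0) : ℕ) ≤ m * (m + 1) := by
    have h3 : ∀ a : Fin K, ∑ b : Fin K, ((if (a : ℕ) + b < m then 1 else 0) +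
        (if 2 * K - 1 - m ≤ (a : ℕ) + b then 1 else 0) : ℕ) = (m - a) + (m - (K - 1 - a)) := by
      rintro ⟨a, ha⟩
      rw [Fin.sum_univ_eq_sum_range (fun b => ((if a + b < m then 1 else 0) +
        (if 2 * K - 1 - m ≤ a + b then 1 else 0) : ℕ)) K]
      simp only [Finset.sum_add_distrib, ← Finset.card_filter]
      have h2 : (Finset.range K).filter (fun b => a + b < m) = Finset.range (m - a) := by
        ext b; simp only [Finset.mem_filter, Finset.mem_range]; omega
      have h3 : (Finset.range K).filter (fun b => 2 * K - 1 - m ≤ a + b) =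
          Finset.Ico (2 * K - 1 - m - a) K := by
        ext b; simp only [Finset.mem_filter, Finset.mem_range, Finset.mem_Ico]; omega
      rw [h2, h3, Nat.card_Ico, Finset.card_range]
      omega
    simp only [h3]
    rw [Fin.sum_univ_eq_sum_range (fun a => (m - a) + (m - (K - 1 - a))) K,
      Finset.sum_add_distrib, Finset.sum_range_reflect (fun a => m - a) K]
    have := sum_range_sub_le K m
    omega
  simp only [h1, ← Finset.mul_sum]
  have := Real.log_nonneg (x := 2) (by norm_num)
  exact_mod_cast mul_le_mul_of_nonneg_left (by exact_mod_cast h2 :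
    ((∑ a : Fin K, ∑ b : Fin K, ((if (a : ℕ) + b < m then 1 else 0) +
        (if 2 * K - 1 - m ≤ (a : ℕ) + b then 1 else 0) : ℕ) : ℕ) : ℝ) ≤ (m * (m + 1) : ℕ))
    (by positivity : 0 ≤ 2 * Real.log 2)

/-! ### Stirling bounds and the count for fixed block numbers -/

/-- The remainder `1 + log n` also makes the bound true at `n = 0`, where `log 0 = 0`. -/
theorem log_factorial_le (n : ℕ) :
    Real.log (n.factorial) ≤ n * Real.log n - n + (1 + Real.log n) := by
  rcases Nat.eq_zero_or_pos n with rfl | hn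
  · simp
  induction n, hn using Nat.le_induction with
  | base => simp
  | succ n hn ih =>
    have hn' : (0 : ℝ) < n := by exact_mod_cast hn
    have h := Real.log_le_sub_one_of_pos (x := (n : ℝ) / (n + 1)) (by positivity)
    rw [Real.log_div (by positivity) (by positivity)] at h
    have h2 : ((n : ℝ) + 1) * (Real.log n - Real.log (n + 1)) ≤ -1 := by
      calc _ ≤ ((n : ℝ) + 1) * (n / (n + 1) - 1) := by gcongr
        _ = -1 := by field_simp; ring
    rw [Nat.factorial_succ, Nat.cast_mul, Real.log_mul (by positivity) (by positivity)]
    push_cast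
    nlinarith

theorem le_log_factorial (n : ℕ) : n * Real.log n - n ≤ Real.log (n.factorial) := by
  rcases Nat.eq_zero_or_pos n with rfl | hn
  · simp
  have h := Stirling.le_log_factorial_stirling hn.ne'
  have h1 := Real.log_nonneg (x := n) (by exact_mod_cast hn)
  have h2 := Real.log_nonneg (x := 2 * Real.pi) (by linarith [Real.pi_gt_three])
  linarith

/-- The bound for block length `s = D * w` and profile `w • bandMatrix K R`, on `M = K * D * w`
points. The term `w * L` is the entropy lost to the doubled corners. -/
theorem le_log_card_permBall_mul {K R w r : ℕ} (hR : R < K) (hw : 0 < w)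
    (hr : (R + 1) * (min (2 * R + 1) K * w) ≤ r + 1) {M L : ℝ}
    (hM : M = (K * (min (2 * R + 1) K * w) : ℕ))
    (hL : L = 2 * Real.log 2 * (min R (K - 1 - R) * (min R (K - 1 - R) + 1) : ℕ)) :
    M * Real.log M - M - M * Real.log (K / (min (2 * R + 1) K : ℕ)) - w * L
        - K ^ 2 * (1 + Real.log M) ≤
      Real.log (permBall r
        (1 : Equiv.Perm (Fin (K * (min (2 * R + 1) K * w))))).card := by
  set D := min (2 * R + 1) K with hD
  have hK : 0 < K := by omega
  have hD0 : 0 < D := by omega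
  have key := factorial_pow_le_prod_mul_card_permBall (K := K) (s := D * w) (r := r) (R := R)
    (fun a b => bandMatrix K R a b * w)
    (fun a => by rw [← Finset.sum_mul, sum_bandMatrix hR])
    (fun b => by simp only [bandMatrix_comm K R _ b]; rw [← Finset.sum_mul, sum_bandMatrix hR])
    (fun a b h => by
      have := le_add_of_bandMatrix_ne_zero a.2 b.2 (left_ne_zero_of_mul h)
      omega) hr
  have hcard : 0 < (permBall r (1 : Equiv.Perm (Fin (K * (D * w))))).card :=
    Finset.card_pos.2 ⟨1, one_mem_permBall r⟩
  have key2 := Real.log_le_log (by positivity) (by exact_mod_cast key :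
    (((D * w).factorial : ℝ)) ^ (2 * K) ≤ (∏ a : Fin K, ∏ b : Fin K,
      ((bandMatrix K R a b * w).factorial : ℝ)) *
      (permBall r (1 : Equiv.Perm (Fin (K * (D * w))))).card)
  rw [Real.log_mul (by positivity) (by positivity), Real.log_pow, Real.log_prod
    (fun _ _ => by positivity)] at key2
  simp only [fun a : Fin K => Real.log_prod (s := Finset.univ)
    (f := fun b : Fin K => ((bandMatrix K R a b * w).factorial : ℝ))
    (fun _ _ => by positivity)] at key2
  have hw' : (0 : ℝ) < w := by exact_mod_cast hw
  have hK' : (0 : ℝ) < K := by exact_mod_cast hK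
  have hD' : (0 : ℝ) < D := by exact_mod_cast hD0
  have hM0 : M = K * (D * w) := by rw [hM]; push_cast; ring
  have hsum : ∑ a : Fin K, ∑ b : Fin K, (bandMatrix K R a b : ℝ) = K * D := by
    have : ∀ a : Fin K, ∑ b : Fin K, (bandMatrix K R a b : ℝ) = D := fun a => by
      exact_mod_cast sum_bandMatrix hR a
    simp [this]
  have hent := sum_bandMatrix_mul_log_le hR
  rw [← hL] at hent
  have hfac : ∀ a b : Fin K, Real.log ((bandMatrix K R a b * w).factorial : ℝ) ≤
      w * ((bandMatrix K R a b : ℝ) * Real.log (bandMatrix K R a b)) +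
        (w * Real.log w - w) * bandMatrix K R a b + (1 + Real.log M) := by
    intro a b
    have hB : bandMatrix K R a b ≤ D := by
      rw [hD, ← sum_bandMatrix hR a]
      exact Finset.single_le_sum (f := fun b : Fin K => bandMatrix K R a b)
        (fun _ _ => Nat.zero_le _) (Finset.mem_univ b)
    have h := log_factorial_le (bandMatrix K R a b * w)
    -- empty blocks contribute `log 0! = 0`, and `0 * log 0 = 0`
    rcases Nat.eq_zero_or_pos (bandMatrix K R a b) with h0 | h0
    · have : 0 ≤ Real.log M := by
        rw [hM]; exact Real.log_natCast_nonneg _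
      simp [h0]; linarith
    · have h0' : (0 : ℝ) < bandMatrix K R a b := by exact_mod_cast h0
      have hle : Real.log ((bandMatrix K R a b * w : ℕ) : ℝ) ≤ Real.log M := by
        refine Real.log_le_log (by exact_mod_cast Nat.mul_pos h0 hw) ?_
        rw [hM]
        exact_mod_cast (Nat.mul_le_mul_right w hB).trans (Nat.le_mul_of_pos_left _ hK)
      have e : Real.log ((bandMatrix K R a b * w : ℕ) : ℝ) =
          Real.log (bandMatrix K R a b) + Real.log w := by
        rw [Nat.cast_mul, Real.log_mul h0'.ne' hw'.ne']
      refine h.trans ?_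
      refine add_le_add ?_ (by linarith)
      rw [e]; push_cast; linarith
  have hfac2 : ∑ a : Fin K, ∑ b : Fin K, Real.log ((bandMatrix K R a b * w).factorial : ℝ) ≤
      w * L + (w * Real.log w - w) * (K * D) + K ^ 2 * (1 + Real.log M) := by
    calc _ ≤ ∑ a : Fin K, ∑ b : Fin K,
          (w * ((bandMatrix K R a b : ℝ) * Real.log (bandMatrix K R a b)) +
            (w * Real.log w - w) * bandMatrix K R a b + (1 + Real.log M)) :=
          Finset.sum_le_sum fun a _ => Finset.sum_le_sum fun b _ => hfac a b
      _ = w * (∑ a : Fin K, ∑ b : Fin K,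
            (bandMatrix K R a b : ℝ) * Real.log (bandMatrix K R a b)) +
          (w * Real.log w - w) * (∑ a : Fin K, ∑ b : Fin K, (bandMatrix K R a b : ℝ)) +
          K ^ 2 * (1 + Real.log M) := by
          simp only [Finset.sum_add_distrib, Finset.mul_sum, Finset.sum_const,
            Finset.card_univ, Fintype.card_fin, nsmul_eq_mul]
          ring
      _ ≤ _ := by rw [hsum]; gcongr
  have hs := le_log_factorial (D * w)
  have e1 : Real.log ((D * w : ℕ) : ℝ) = Real.log D + Real.log w := by
    rw [Nat.cast_mul, Real.log_mul hD'.ne' hw'.ne']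
  have e2 : Real.log M = Real.log K + (Real.log D + Real.log w) := by
    rw [hM0, Real.log_mul hK'.ne' (by positivity), Real.log_mul hD'.ne' hw'.ne']
  have hs2 : 2 * K * ((D * w : ℝ) * (Real.log D + Real.log w) - D * w) ≤
      2 * K * Real.log ((D * w).factorial : ℝ) := by
    rw [e1] at hs; push_cast at hs; gcongr
  rw [Real.log_div hK'.ne' hD'.ne']
  push_cast at key2
  have e3 : M * Real.log M - M - M * (Real.log K - Real.log D) - w * L
        - K ^ 2 * (1 + Real.log M) = 2 * K * ((D * w : ℝ) * (Real.log D + Real.log w) - D * w) -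
      (w * L + (w * Real.log w - w) * (K * D) + K ^ 2 * (1 + Real.log M)) := by
    rw [e2, hM0]; ring
  linarith

/-! ### Asymptotics -/

open Filter Topology

/-- The loss per point, in natural logarithms and relative to `log n! ~ n log n - n`, of the count
of permutations whose block profile is a multiple of `bandMatrix K R`, in the limit `K → ∞`,
`R / K → ρ`. The minima cover `ρ ≤ 1/2` and `ρ ≥ 1/2` at once. -/
noncomputable def profileRate (ρ : ℝ) : ℝ :=
  -Real.log (min (2 * ρ) 1) + 2 * Real.log 2 * min ρ (1 - ρ) ^ 2 / min (2 * ρ) 1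

/-- For `n` not divisible by `K * D`, the block construction is applied to the largest multiple
`m ≤ n` of `K * D`; this costs `O(log n)`. -/
theorem le_log_card_permBall {K R n r : ℕ} (hR : R < K) (hn : K * min (2 * R + 1) K ≤ n)
    (hr : (R + 1) * (min (2 * R + 1) K * (n / (K * min (2 * R + 1) K))) ≤ r + 1) :
    n * Real.log n - n * (1 + (Real.log (K / (min (2 * R + 1) K : ℕ)) +
        2 * Real.log 2 * (min R (K - 1 - R) * (min R (K - 1 - R) + 1) : ℕ) /
          (K * (min (2 * R + 1) K : ℕ))))
        - ((K * min (2 * R + 1) K : ℕ) + K ^ 2) * (1 + Real.log n) ≤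
      Real.log (permBall r (1 : Equiv.Perm (Fin n))).card := by
  have hDK : min (2 * R + 1) K ≤ K := min_le_right _ _
  have hD0 : 0 < min (2 * R + 1) K := by omega
  have hK0 : 0 < K := by omega
  set w := n / (K * min (2 * R + 1) K) with hw
  have hT0 : 0 < K * min (2 * R + 1) K := Nat.mul_pos hK0 hD0
  have hw0 : 0 < w := Nat.div_pos hn hT0
  have h := le_log_card_permBall_mul hR hw0 hr rfl rfl
  set L : ℝ := 2 * Real.log 2 * (min R (K - 1 - R) * (min R (K - 1 - R) + 1) : ℕ) with hL
  have hL0 : 0 ≤ L := by have := Real.log_nonneg (x := 2) (by norm_num); positivity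
  set D := min (2 * R + 1) K with hD
  set m := K * (D * w) with hm
  have hmT : m = K * D * w := by rw [hm]; ring
  have hmn : m ≤ n := by rw [hmT, hw]; exact Nat.mul_div_le _ _
  have hnm : n < m + K * D := by
    rw [hmT, hw]
    have := Nat.lt_mul_div_succ n hT0
    rwa [Nat.mul_succ] at this
  have hm0 : 0 < m := by rw [hmT]; exact Nat.mul_pos hT0 hw0
  have hmono := Real.log_le_log
    (by exact_mod_cast Finset.card_pos.2 ⟨1, one_mem_permBall r⟩)
    (by exact_mod_cast card_permBall_mono hmn le_rfl :
      ((permBall r (1 : Equiv.Perm (Fin m))).card : ℝ) ≤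
        (permBall r (1 : Equiv.Perm (Fin n))).card)
  refine le_trans ?_ (h.trans hmono)
  have hK' : (0 : ℝ) < K := by exact_mod_cast hK0
  have hD' : (0 : ℝ) < D := by exact_mod_cast hD0
  have hm' : (0 : ℝ) < m := by exact_mod_cast hm0
  have hmn' : (m : ℝ) ≤ n := by exact_mod_cast hmn
  have hn' : (0 : ℝ) < n := hm'.trans_le hmn'
  have hnm' : (n : ℝ) - m ≤ (K * D : ℕ) := by
    have : (n : ℝ) ≤ m + (K * D : ℕ) := by exact_mod_cast hnm.le
    linarith
  have hlogn : 0 ≤ Real.log n := Real.log_natCast_nonneg n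
  have hlogmn : Real.log m ≤ Real.log n := Real.log_le_log hm' hmn'
  have hlogK : 0 ≤ Real.log (K / D) := by
    refine Real.log_nonneg ((one_le_div hD').2 ?_)
    exact_mod_cast hDK
  have hwm : (w : ℝ) * L = m * (L / (K * D)) := by
    rw [hmT]; push_cast; field_simp
  -- `n log n - m log m = (n - m) log n + m log (n / m)` and `log (n / m) ≤ n / m - 1`
  have e1 : (n : ℝ) * Real.log n - m * Real.log m ≤ (K * D : ℕ) * (1 + Real.log n) := by
    have h1 := Real.log_le_sub_one_of_pos (x := (n : ℝ) / m) (by positivity)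
    rw [Real.log_div hn'.ne' hm'.ne'] at h1
    have h2 : (m : ℝ) * (Real.log n - Real.log m) ≤ n - m := by
      calc _ ≤ (m : ℝ) * (n / m - 1) := by gcongr
        _ = n - m := by field_simp
    calc (n : ℝ) * Real.log n - m * Real.log m
        = (n - m) * Real.log n + m * (Real.log n - Real.log m) := by ring
      _ ≤ (n - m) * Real.log n + (n - m) := by gcongr
      _ = (n - m) * (1 + Real.log n) := by ring
      _ ≤ _ := by gcongr
  have e2 : (m : ℝ) * (1 + (Real.log (K / D) + L / (K * D))) ≤
      n * (1 + (Real.log (K / D) + L / (K * D))) := by gcongr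
  have e3 : (K : ℝ) ^ 2 * (1 + Real.log m) ≤ K ^ 2 * (1 + Real.log n) := by gcongr
  rw [hwm]
  linarith

theorem tendsto_block_rate {ρ : ℝ} (h0 : 0 < ρ) {R : ℕ → ℕ}
    (hRK : ∀ᶠ K in atTop, R K < K)
    (hR : Tendsto (fun K : ℕ => (R K : ℝ) / K) atTop (𝓝 ρ)) :
    Tendsto (fun K : ℕ => Real.log (K / (min (2 * R K + 1) K : ℕ)) +
        2 * Real.log 2 * (min (R K) (K - 1 - R K) * (min (R K) (K - 1 - R K) + 1) : ℕ) /
          (K * (min (2 * R K + 1) K : ℕ))) atTop (𝓝 (profileRate ρ)) := by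
  have hpos : 0 < min (2 * ρ) 1 := lt_min (by linarith) one_pos
  have hinv : Tendsto (fun K : ℕ => (1 : ℝ) / K) atTop (𝓝 0) :=
    tendsto_one_div_atTop_nhds_zero_nat
  have hd : Tendsto (fun K : ℕ => min (2 * ((R K : ℝ) / K) + 1 / K) 1) atTop
      (𝓝 (min (2 * ρ) 1)) := by
    have := ((hR.const_mul 2).add hinv).min (tendsto_const_nhds (x := (1 : ℝ)))
    simpa using this
  have hm : Tendsto (fun K : ℕ => min ((R K : ℝ) / K) (1 - 1 / K - (R K : ℝ) / K)) atTop
      (𝓝 (min ρ (1 - ρ))) := by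
    have := hR.min (((tendsto_const_nhds (x := (1 : ℝ))).sub hinv).sub hR)
    simpa using this
  have main := (hd.log hpos.ne').neg.add
    (((hm.mul (hm.add hinv)).const_mul (2 * Real.log 2)).div hd hpos.ne')
  have hlim : profileRate ρ = -Real.log (min (2 * ρ) 1) +
      2 * Real.log 2 * (min ρ (1 - ρ) * (min ρ (1 - ρ) + 0)) / min (2 * ρ) 1 := by
    rw [profileRate]; ring
  rw [hlim]
  refine main.congr' ?_
  filter_upwards [hRK] with K hK
  have hK0 : (0 : ℝ) < K := by exact_mod_cast (Nat.zero_le _).trans_lt hK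
  have eD : min (2 * ((R K : ℝ) / K) + 1 / K) 1 = ((min (2 * R K + 1) K : ℕ) : ℝ) / K := by
    rw [Nat.cast_min, ← min_div_div_right hK0.le, div_self hK0.ne']
    push_cast
    congr 1
    ring
  have em : min ((R K : ℝ) / K) (1 - 1 / K - (R K : ℝ) / K) =
      ((min (R K) (K - 1 - R K) : ℕ) : ℝ) / K := by
    rw [Nat.cast_min, ← min_div_div_right hK0.le, Nat.cast_sub (by omega),
      Nat.cast_sub (by omega)]
    congr 1
    field_simp
    simp
  have hD : (0 : ℝ) < (min (2 * R K + 1) K : ℕ) := by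
    have : 0 < min (2 * R K + 1) K := by omega
    exact_mod_cast this
  simp only [Pi.div_apply]
  rw [eD, em, ← Real.log_inv, inv_div]
  push_cast [-Nat.cast_min]
  field_simp

theorem eventually_le_log_card_permBall {ρ : ℝ} (h0 : 0 < ρ) (h1 : ρ < 1) {ε : ℝ} (hε : 0 < ε) :
    ∀ᶠ n : ℕ in atTop, n * Real.log n - n * (1 + profileRate ρ) - ε * n ≤
      Real.log (permBall ⌊ρ * ((n : ℝ) - 1)⌋₊ (1 : Equiv.Perm (Fin n))).card := by
  -- Subtracting `2` gives `(R + 2) * s ≤ ρ * K * s ≤ ρ * n` for the block length `s ≥ 1`, hence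
  -- `(R + 1) * s ≤ ρ * (n - 1)`, which is the condition for the block band to fit into the ball.
  let R : ℕ → ℕ := fun K => ⌊ρ * K⌋₊ - 2
  have h2 : ∀ᶠ K : ℕ in atTop, 2 ≤ ρ * (K : ℝ) :=
    (tendsto_natCast_atTop_atTop.const_mul_atTop h0).eventually_ge_atTop 2
  have hR2 : ∀ᶠ K : ℕ in atTop, (R K : ℝ) = ⌊ρ * K⌋₊ - 2 ∧ (R K : ℝ) + 2 ≤ ρ * K := by
    filter_upwards [h2] with K hK
    have h3 : 2 ≤ ⌊ρ * (K : ℝ)⌋₊ := Nat.le_floor hK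
    have h4 : (R K : ℝ) = ⌊ρ * K⌋₊ - 2 := by simp only [R]; rw [Nat.cast_sub h3]; norm_num
    have := Nat.floor_le (show 0 ≤ ρ * (K : ℝ) by positivity)
    exact ⟨h4, by linarith⟩
  have hRlt : ∀ᶠ K in atTop, R K < K := by
    filter_upwards [hR2] with K hK
    have : (R K : ℝ) < K := by nlinarith [hK.2, Nat.cast_nonneg (α := ℝ) K]
    exact_mod_cast this
  have hRlim : Tendsto (fun K : ℕ => (R K : ℝ) / K) atTop (𝓝 ρ) := by
    have h3 := ((tendsto_nat_floor_mul_div_atTop h0.le).comp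
      (tendsto_natCast_atTop_atTop (R := ℝ))).sub (tendsto_const_div_atTop_nhds_zero_nat (2 : ℝ))
    rw [sub_zero] at h3
    refine h3.congr' ?_
    filter_upwards [hR2] with K hK
    rw [hK.1]; simp [sub_div]
  obtain ⟨K, hrate, ⟨-, hRK⟩, hlt⟩ := (((tendsto_block_rate h0 hRlt hRlim).eventually_lt_const
    (show profileRate ρ < profileRate ρ + ε / 2 by linarith)).and (hR2.and hRlt)).exists
  have hsmall : Tendsto (fun n : ℕ => ((K * min (2 * R K + 1) K : ℕ) + (K : ℝ) ^ 2) *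
      ((1 + Real.log n) / n)) atTop (𝓝 0) := by
    have h3 := ((tendsto_const_div_atTop_nhds_zero_nat (1 : ℝ)).add
      ((Real.isLittleO_log_id_atTop.tendsto_div_nhds_zero).comp
        (tendsto_natCast_atTop_atTop (R := ℝ)))).const_mul
      ((K * min (2 * R K + 1) K : ℕ) + (K : ℝ) ^ 2)
    simp only [add_zero, mul_zero] at h3
    refine h3.congr fun n => ?_
    simp [add_div]
  filter_upwards [eventually_ge_atTop (K * min (2 * R K + 1) K), eventually_gt_atTop 0,
    hsmall.eventually_lt_const (half_pos hε)] with n hn hn0 hnε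
  have hn' : (0 : ℝ) < n := by exact_mod_cast hn0
  have hr : (R K + 1) * (min (2 * R K + 1) K * (n / (K * min (2 * R K + 1) K))) ≤
      ⌊ρ * ((n : ℝ) - 1)⌋₊ + 1 := by
    set s := min (2 * R K + 1) K * (n / (K * min (2 * R K + 1) K)) with hs
    have hsn : K * s ≤ n := by
      rw [hs, ← mul_assoc]; exact Nat.mul_div_le _ _
    have hs1 : 1 ≤ s := by
      have hD0 : 0 < min (2 * R K + 1) K := by omega
      exact Nat.mul_pos hD0 (Nat.div_pos hn (Nat.mul_pos (by omega) hD0))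
    have hsn' : (K : ℝ) * s ≤ n := by exact_mod_cast hsn
    have hs1' : (1 : ℝ) ≤ s := by exact_mod_cast hs1
    have hfl := Nat.lt_floor_add_one (ρ * ((n : ℝ) - 1))
    have h4 : ((R K : ℝ) + 2) * s ≤ ρ * K * s := by gcongr
    have h5 : ρ * (K * s) ≤ ρ * n := by gcongr
    have : (((R K + 1) * s : ℕ) : ℝ) ≤ (⌊ρ * ((n : ℝ) - 1)⌋₊ + 1 : ℕ) := by
      push_cast; nlinarith
    exact_mod_cast this
  refine le_trans ?_ (le_log_card_permBall hlt hn hr)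
  rw [← mul_div_assoc, div_lt_iff₀ hn'] at hnε
  have := mul_le_mul_of_nonneg_left hrate.le hn'.le
  linarith

/-- A sequence `b` with `log₂ (b n) ≥ F n - o(n)` has a minorant `φ` with `log₂ (φ n) = F n + o(n)`,
namely the minimum of `b n` and `2 ^ F n`. -/
theorem exists_lower_bound_of_isLittleO {b F : ℕ → ℝ} (hb : ∀ n, 0 < b n)
    (hF : ∀ ε > 0, ∀ᶠ n : ℕ in atTop, F n - ε * n ≤ Real.logb 2 (b n)) :
    ∃ φ : ℕ → ℝ, (∀ n, 0 < φ n) ∧ (∀ n, φ n ≤ b n) ∧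
      (fun n => Real.logb 2 (φ n) - F n) =o[atTop] fun n : ℕ => (n : ℝ) := by
  refine ⟨fun n => min ((2 : ℝ) ^ F n) (b n), fun n => lt_min (by positivity) (hb n),
    fun n => min_le_right _ _, Asymptotics.isLittleO_iff.2 fun ε hε => ?_⟩
  filter_upwards [hF ε hε] with n hn
  have hlog : Real.logb 2 (min ((2 : ℝ) ^ F n) (b n)) = min (F n) (Real.logb 2 (b n)) := by
    have h2 : Real.logb 2 ((2 : ℝ) ^ F n) = F n := Real.logb_rpow (by norm_num) (by norm_num)
    rcases le_total ((2 : ℝ) ^ F n) (b n) with h | h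
    · rw [min_eq_left h, h2, min_eq_left]
      rw [← h2]; exact Real.logb_le_logb_of_le (by norm_num) (by positivity) h
    · rw [min_eq_right h, min_eq_right]
      rw [← h2]; exact Real.logb_le_logb_of_le (by norm_num) (hb n) h
  have hnε : 0 ≤ ε * n := by positivity
  rw [hlog, Real.norm_eq_abs, Real.norm_natCast, abs_le]
  constructor
  · have : F n - ε * n ≤ min (F n) (Real.logb 2 (b n)) := le_min (by linarith) hn
    linarith
  · linarith [min_le_left (F n) (Real.logb 2 (b n))]

theorem one_add_profileRate_div_log_two_of_le {ρ : ℝ} (h0 : 0 < ρ) (h : ρ ≤ 1 / 2) :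
    (1 + profileRate ρ) / Real.log 2 =
      Real.logb 2 (Real.exp 1) - 1 + ρ - Real.logb 2 ρ := by
  have hl : Real.log 2 ≠ 0 := (Real.log_pos (by norm_num)).ne'
  rw [profileRate, min_eq_left (by linarith), min_eq_left (by linarith),
    Real.log_mul (by norm_num) h0.ne', Real.logb, Real.logb, Real.log_exp]
  field_simp
  ring

theorem one_add_profileRate_div_log_two_of_ge {ρ : ℝ} (h : 1 / 2 ≤ ρ) :
    (1 + profileRate ρ) / Real.log 2 =
      Real.logb 2 (Real.exp 1) + 2 * (1 - ρ) ^ 2 := by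
  have hl : Real.log 2 ≠ 0 := (Real.log_pos (by norm_num)).ne'
  rw [profileRate, min_eq_right (by linarith), min_eq_right (by linarith),
    Real.log_one, Real.logb, Real.log_exp]
  field_simp
  ring

theorem mainTheorem2 (ρ : ℝ) (hρ0 : 0 < ρ) (hρ1 : ρ < 1) :
    ∃ φ₂ : ℕ → ℝ,
      (∀ n : ℕ, 0 < φ₂ n) ∧
      (∀ n r : ℕ, 1 ≤ n → (r : ℝ) = ρ * ((n : ℝ) - 1) →
        ∀ f : Equiv.Perm (Fin n), φ₂ n ≤ ((permBall r f).card : ℝ)) ∧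
      (ρ ≤ 1 / 2 →
        Asymptotics.IsLittleO Filter.atTop
          (fun n : ℕ => Real.logb 2 (φ₂ n) -
            ((n : ℝ) * Real.logb 2 (n : ℝ) -
              (n : ℝ) * (Real.logb 2 (Real.exp 1) - 1 + ρ - Real.logb 2 ρ)))
          (fun n : ℕ => (n : ℝ))) ∧
      (1 / 2 ≤ ρ →
        Asymptotics.IsLittleO Filter.atTop
          (fun n : ℕ => Real.logb 2 (φ₂ n) -
            ((n : ℝ) * Real.logb 2 (n : ℝ) -
              (n : ℝ) * (Real.logb 2 (Real.exp 1) + 2 * (1 - ρ) ^ 2)))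
          (fun n : ℕ => (n : ℝ))) := by
  have hl : 0 < Real.log 2 := Real.log_pos (by norm_num)
  obtain ⟨φ, hφ0, hφ, hφF⟩ := exists_lower_bound_of_isLittleO
    (b := fun n => ((permBall ⌊ρ * ((n : ℝ) - 1)⌋₊ (1 : Equiv.Perm (Fin n))).card : ℝ))
    (F := fun n => n * Real.logb 2 n - n * ((1 + profileRate ρ) / Real.log 2))
    (fun n => by exact_mod_cast Finset.card_pos.2 ⟨1, one_mem_permBall _⟩) fun ε hε => by
      filter_upwards [eventually_le_log_card_permBall hρ0 hρ1 (mul_pos hε hl)] with n hn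
      rw [Real.logb, Real.logb, le_div_iff₀ hl]
      refine le_trans (le_of_eq ?_) hn
      field_simp
  refine ⟨φ, hφ0, fun n r _ hr f => ?_, fun h => ?_, fun h => ?_⟩
  · have : ⌊ρ * ((n : ℝ) - 1)⌋₊ = r := by rw [← hr, Nat.floor_natCast]
    rw [card_permBall_eq_one, ← this]
    exact hφ n
  · rw [← one_add_profileRate_div_log_two_of_le hρ0 h]
    exact hφF
  · rw [← one_add_profileRate_div_log_two_of_ge h]
    exact hφF
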